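/- **Setting.** Types are built from atomic types and $\bot$ with $\to$; $\neg A$ abbreviates $A\to\bot$, and $lh(A)$ is the number of arrows in $A$. The terms of the simply typed $\lambda\mu\rho\theta$-calculus, taken up to renaming of bound variables, are $M ::= x \mid \lambda x.M \mid \mu\alpha.M \mid [\alpha]M \mid (M\,M)$ with $\lambda$-variables $x$ and $\mu$-variables $\alpha$, typed by the rules: $\Gamma,x:A\vdash x:A$; if $\Gamma,x:A\vdash M:B$ then $\Gamma\vdash\lambda x.M:A\to B$; if $\Gamma\vdash M:A\to B$ and $\Gamma\vdash N:A$ then $\Gamma\vdash (M\,N):B$; if $\Gamma,\alpha:\neg A\vdash M:A$ then $\Gamma,\alpha:\neg A\vdash[\alpha]M:\bot$; if $\Gamma,\alpha:\neg A\vdash M:\bot$ then $\Gamma\vdash\mu\alpha.M:A$. All terms are typed, with a fixed typing, so that every subterm $U$ has a type $type(U)$; reduction preserves it. The complexity is $comp(x)=1$, $comp(\lambda x.M)=comp(\mu\alpha.M)=comp([\alpha]M)=comp(M)+1$, $comp(M\,N)=comp(M)+comp(N)$. The redexes and their contraction rules (applied inside arbitrary contexts) are - $\beta$: $(\lambda x.P)Q\to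 P[x:=Q]$; - $\mu$: $(\mu\alpha.P)Q\to\mu\alpha.P[\alpha:=_rQ]$, where $P[\alpha:=_rQ]$ is obtained by recursively replacing every subterm $[\alpha]U$ of $P$ (with $\alpha$ free) by $[\alpha](U\,Q)$; - $\rho$: $[\alpha]\mu\beta.P\to P[\beta:=\alpha]$; - $\theta$: $\mu\alpha.[\alpha]P\to P$, provided $\alpha$ is not free in $P$. All substitutions avoid capture. A term is in normal form if it contains no redex. The rank of a redex is $lh(type(\lambda x.P))$ for $(\lambda x.P)Q$, $lh(type(\mu\alpha.P))$ for $(\mu\alpha.P)Q$, $lh(type(\mu\beta.P))$ for $[\alpha]\mu\beta.P$, and $lh(type(\mu\alpha.[\alpha]P))$ for $\mu\alpha.[\alpha]P$. The rank $rank(M)$ of a term is the maximum of the ranks of the redexes occurring in $M$ (and $0$ if there is none). For a redex occurrence $R$ in $M$ let $m(R,M)$ be: the number of free occurrences of $\alpha$ in $P$, if $R=(\mu\alpha.P)Q$; $2\,comp(M)-2$, if $R=(\lambda x.P)Q$; $1$, if $R=[\alpha]\mu\beta.P$; and $2n-1$, if $R=\mu\alpha.[\alpha]P$ is a $\theta$-redex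 which has exactly $n$ arguments in $M$ (that is, it stands in $M$ as the head of a maximal application $(R\,P_1\dots P_n)$). For a finite, possibly empty, reduction sequence $\sigma$ of the form $M_1\to^{R_1}M_2\to^{R_2}\cdots\to^{R_n}M_{n+1}$, its measure is $$\mathcal M(\sigma)=\prod_{i=1}^{n}\bigl(1+\max(m(R_i,M_i),2)\bigr).$$ The sequence $\sigma$ is good if for every $i$ the redex $R_i$ is the leftmost, innermost redex of maximal rank of $M_i$: among the redex occurrences of rank $rank(M_i)$ in $M_i$ that properly contain no other redex occurrence of rank $rank(M_i)$, it is the leftmost one. Finally, $tower(0,m)=m$ and $tower(n+1,m)=2^{tower(n,m)}$. **Theorem.** Let $M$ be a typed term with $rank(M)=k$, and let $\sigma$ be a good reduction sequence from $M$ to a normal form $N$. Then $\mathcal M(\sigma)<tower(k+1,comp(M))$. -/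

import Mathlib

namespace LambdaMu

/-- Simple types: atomic types, `⊥`, and arrows. The negation `¬ A` is `A → ⊥`. -/
inductive Ty : Type
  | atom (n : ℕ) : Ty
  | bot : Ty
  | arr (A B : Ty) : Ty

/-- The length of a type: its number of arrows. -/
def Ty.lh : Ty → ℕ
  | .atom _ => 0
  | .bot => 0
  | .arr A B => A.lh + B.lh + 1

/-- `Idx Γ A`: a (de Bruijn) variable declared with type `A` in the context `Γ`. -/
inductive Idx : List Ty → Ty → Type
  | zero {Γ : List Ty} {A : Ty} : Idx (A :: Γ) A
  | succ {Γ : List Ty} {A B : Ty} (i : Idx Γ A) : Idx (B :: Γ) A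

/-- The position of a declaration in its context. -/
def Idx.toNat : {Γ : List Ty} → {A : Ty} → Idx Γ A → ℕ
  | _, _, .zero => 0
  | _, _, .succ i => i.toNat + 1

/-- Simply typed `λμ`-terms up to `α`-equivalence, i.e. derivations of `Γ; Δ ⊢ M : A`.
`Γ` lists the types of the `λ`-variables; an entry `A` of `Δ` declares a `μ`-variable
`α : ¬ A`. The constructors are the typing rules: `named α M` is `[α] M`. -/
inductive Tm : List Ty → List Ty → Ty → Type
  | var {Γ Δ : List Ty} {A : Ty} (x : Idx Γ A) : Tm Γ Δ A
  | lam {Γ Δ : List Ty} {A B : Ty} (M : Tm (A :: Γ) Δ B) : Tm Γ Δ (.arr A B)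
  | app {Γ Δ : List Ty} {A B : Ty} (M : Tm Γ Δ (.arr A B)) (N : Tm Γ Δ A) : Tm Γ Δ B
  | named {Γ Δ : List Ty} {A : Ty} (α : Idx Δ A) (M : Tm Γ Δ A) : Tm Γ Δ .bot
  | mu {Γ Δ : List Ty} {A : Ty} (M : Tm Γ (A :: Δ) .bot) : Tm Γ Δ A

/-- The complexity of a term. -/
def Tm.comp : {Γ Δ : List Ty} → {A : Ty} → Tm Γ Δ A → ℕ
  | _, _, _, .var _ => 1
  | _, _, _, .lam M => M.comp + 1
  | _, _, _, .app M N => M.comp + N.comp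
  | _, _, _, .named _ M => M.comp + 1
  | _, _, _, .mu M => M.comp + 1

/-- The number of free occurrences in a term of the `μ`-variable with de Bruijn index `n`. -/
def Tm.muCount : {Γ Δ : List Ty} → {A : Ty} → ℕ → Tm Γ Δ A → ℕ
  | _, _, _, _, .var _ => 0
  | _, _, _, n, .lam M => M.muCount n
  | _, _, _, n, .app M N => M.muCount n + N.muCount n
  | _, _, _, n, .named α M => (if α.toNat = n then 1 else 0) + M.muCount n
  | _, _, _, n, .mu M => M.muCount (n + 1)

/-! ### Renaming and the two substitutions -/

/-- Renamings of variables. -/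
abbrev Ren (Γ Γ' : List Ty) : Type := ∀ A : Ty, Idx Γ A → Idx Γ' A

/-- A renaming below a binder. -/
def Ren.lift {Γ Γ' : List Ty} (f : Ren Γ Γ') (B : Ty) : Ren (B :: Γ) (B :: Γ')
  | _, .zero => .zero
  | _, .succ i => .succ (f _ i)

/-- Simultaneous renaming of `λ`-variables (by `f`) and of `μ`-variables (by `g`). -/
def Tm.ren : {Γ Γ' Δ Δ' : List Ty} → {A : Ty} → Ren Γ Γ' → Ren Δ Δ' → Tm Γ Δ A → Tm Γ' Δ' A
  | _, _, _, _, _, f, _, .var x => .var (f _ x)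
  | _, _, _, _, _, f, g, .lam M => .lam (M.ren (f.lift _) g)
  | _, _, _, _, _, f, g, .app M N => .app (M.ren f g) (N.ren f g)
  | _, _, _, _, _, f, g, .named α M => .named (g _ α) (M.ren f g)
  | _, _, _, _, _, f, g, .mu M => .mu (M.ren f (g.lift _))

/-- Weakening by a fresh `λ`-variable. -/
def Tm.wkLam {Γ Δ : List Ty} {A : Ty} (B : Ty) (M : Tm Γ Δ A) : Tm (B :: Γ) Δ A :=
  M.ren (fun _ i => i.succ) (fun _ i => i)

/-- Weakening by a fresh `μ`-variable. A term over `B :: Δ` does not contain the newest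
`μ`-variable free exactly when it is of the form `M.wkMu B`. -/
def Tm.wkMu {Γ Δ : List Ty} {A : Ty} (B : Ty) (M : Tm Γ Δ A) : Tm Γ (B :: Δ) A :=
  M.ren (fun _ i => i) (fun _ i => i.succ)

/-- Simultaneous substitutions for `λ`-variables. -/
abbrev Sub (Γ Γ' Δ : List Ty) : Type := ∀ A : Ty, Idx Γ A → Tm Γ' Δ A

/-- A substitution below a `λ`-binder. -/
def Sub.liftLam {Γ Γ' Δ : List Ty} (s : Sub Γ Γ' Δ) (B : Ty) : Sub (B :: Γ) (B :: Γ') Δ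
  | _, .zero => .var .zero
  | _, .succ i => (s _ i).wkLam B

/-- A substitution below a `μ`-binder. -/
def Sub.liftMu {Γ Γ' Δ : List Ty} (s : Sub Γ Γ' Δ) (B : Ty) : Sub Γ Γ' (B :: Δ) :=
  fun _ i => (s _ i).wkMu B

/-- Capture-avoiding simultaneous substitution for `λ`-variables. -/
def Tm.sub : {Γ Γ' Δ : List Ty} → {A : Ty} → Sub Γ Γ' Δ → Tm Γ Δ A → Tm Γ' Δ A
  | _, _, _, _, s, .var x => s _ x
  | _, _, _, _, s, .lam M => .lam (M.sub (s.liftLam _))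
  | _, _, _, _, s, .app M N => .app (M.sub s) (N.sub s)
  | _, _, _, _, s, .named α M => .named α (M.sub s)
  | _, _, _, _, s, .mu M => .mu (M.sub (s.liftMu _))

/-- The substitution `x := N` for the newest `λ`-variable. -/
def Sub.single {Γ Δ : List Ty} {B : Ty} (N : Tm Γ Δ B) : Sub (B :: Γ) Γ Δ
  | _, .zero => N
  | _, .succ i => .var i

/-- `M[x := N]`, where `x` is the newest `λ`-variable. -/
def Tm.subst {Γ Δ : List Ty} {A B : Ty} (M : Tm (B :: Γ) Δ A) (N : Tm Γ Δ B) : Tm Γ Δ A :=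
  M.sub (Sub.single N)

/-- What a structural substitution may do to the subterms `[α] U` for a given `α`:
`var β` turns them into `[β] U`, and `arg β N` turns them into `[β] (U N)`. -/
inductive Name (Γ Δ : List Ty) : Ty → Type
  | var {A : Ty} (β : Idx Δ A) : Name Γ Δ A
  | arg {A B : Ty} (β : Idx Δ B) (N : Tm Γ Δ A) : Name Γ Δ (.arr A B)

/-- The renaming of a `Name`. -/
def Name.ren {Γ Γ' Δ Δ' : List Ty} (f : Ren Γ Γ') (g : Ren Δ Δ') :
    {A : Ty} → Name Γ Δ A → Name Γ' Δ' A
  | _, .var β => .var (g _ β)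
  | _, .arg β N => .arg (g _ β) (N.ren f g)

/-- The term that replaces `[α] U`. -/
def Name.plug {Γ Δ : List Ty} : {A : Ty} → Name Γ Δ A → Tm Γ Δ A → Tm Γ Δ .bot
  | _, .var β, U => .named β U
  | _, .arg β N, U => .named β (.app U N)

/-- Structural substitutions for `μ`-variables. -/
abbrev MSub (Γ Δ Δ' : List Ty) : Type := ∀ A : Ty, Idx Δ A → Name Γ Δ' A

/-- A structural substitution below a `λ`-binder. -/
def MSub.liftLam {Γ Δ Δ' : List Ty} (s : MSub Γ Δ Δ') (B : Ty) : MSub (B :: Γ) Δ Δ' :=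
  fun _ i => (s _ i).ren (fun _ j => j.succ) (fun _ j => j)

/-- A structural substitution below a `μ`-binder. -/
def MSub.liftMu {Γ Δ Δ' : List Ty} (s : MSub Γ Δ Δ') (B : Ty) : MSub Γ (B :: Δ) (B :: Δ')
  | _, .zero => .var .zero
  | _, .succ i => (s _ i).ren (fun _ j => j) (fun _ j => j.succ)

/-- Capture-avoiding simultaneous structural substitution. -/
def Tm.msub : {Γ Δ Δ' : List Ty} → {A : Ty} → MSub Γ Δ Δ' → Tm Γ Δ A → Tm Γ Δ' A
  | _, _, _, _, _, .var x => .var x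
  | _, _, _, _, s, .lam M => .lam (M.msub (s.liftLam _))
  | _, _, _, _, s, .app M N => .app (M.msub s) (N.msub s)
  | _, _, _, _, s, .named α M => (s _ α).plug (M.msub s)
  | _, _, _, _, s, .mu M => .mu (M.msub (s.liftMu _))

/-- The structural substitution `α :=ᵣ N` for the newest `μ`-variable `α`, which changes its
declaration from `¬ (A → B)` to `¬ B`. -/
def MSub.single {Γ Δ : List Ty} {A B : Ty} (N : Tm Γ Δ A) :
    MSub Γ (Ty.arr A B :: Δ) (B :: Δ)
  | _, .zero => .arg .zero (N.wkMu B)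
  | _, .succ i => .var i.succ

/-- `M[α :=ᵣ N]`, where `α` is the newest `μ`-variable. -/
def Tm.msubst {Γ Δ : List Ty} {A B C : Ty} (M : Tm Γ (Ty.arr A B :: Δ) C) (N : Tm Γ Δ A) :
    Tm Γ (B :: Δ) C :=
  M.msub (MSub.single N)

/-- The renaming `β := α`, where `β` is the newest variable. -/
def Ren.single {Δ : List Ty} {B : Ty} (α : Idx Δ B) : Ren (B :: Δ) Δ
  | _, .zero => α
  | _, .succ i => i

/-- `M[β := α]`, where `β` is the newest `μ`-variable. -/
def Tm.renMu {Γ Δ : List Ty} {A B : Ty} (M : Tm Γ (B :: Δ) A) (α : Idx Δ B) : Tm Γ Δ A :=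
  M.ren (fun _ i => i) (Ren.single α)

/-! ### Redex occurrences and reduction sequences -/

/-- The occurrences of redexes in a term. The first four constructors say that the term itself
is a redex: `(λx.P) Q`, `(μα.P) Q`, `[α] μβ.P`, and `μα.[α] U` where `α` is not free in `U`
(that is, `U` is the weakening of some `P`). -/
inductive RedexOcc : {Γ Δ : List Ty} → {A : Ty} → Tm Γ Δ A → Type
  | beta {Γ Δ : List Ty} {A B : Ty} (P : Tm (A :: Γ) Δ B) (Q : Tm Γ Δ A) :
      RedexOcc (.app (.lam P) Q)
  | mu {Γ Δ : List Ty} {A B : Ty} (P : Tm Γ (Ty.arr A B :: Δ) .bot) (Q : Tm Γ Δ A) :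
      RedexOcc (.app (.mu P) Q)
  | rho {Γ Δ : List Ty} {A : Ty} (α : Idx Δ A) (P : Tm Γ (A :: Δ) .bot) :
      RedexOcc (.named α (.mu P))
  | theta {Γ Δ : List Ty} {A : Ty} (U : Tm Γ (A :: Δ) A) (P : Tm Γ Δ A) (h : P.wkMu A = U) :
      RedexOcc (.mu (.named .zero U))
  | inLam {Γ Δ : List Ty} {A B : Ty} {M : Tm (A :: Γ) Δ B} (r : RedexOcc M) :
      RedexOcc (.lam M)
  | inFn {Γ Δ : List Ty} {A B : Ty} {M : Tm Γ Δ (.arr A B)} (r : RedexOcc M) (N : Tm Γ Δ A) :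
      RedexOcc (.app M N)
  | inArg {Γ Δ : List Ty} {A B : Ty} (M : Tm Γ Δ (.arr A B)) {N : Tm Γ Δ A} (r : RedexOcc N) :
      RedexOcc (.app M N)
  | inNamed {Γ Δ : List Ty} {A : Ty} (α : Idx Δ A) {M : Tm Γ Δ A} (r : RedexOcc M) :
      RedexOcc (.named α M)
  | inMu {Γ Δ : List Ty} {A : Ty} {M : Tm Γ (A :: Δ) .bot} (r : RedexOcc M) :
      RedexOcc (.mu M)

/-- The result of reducing the given redex occurrence. -/
def RedexOcc.contract : {Γ Δ : List Ty} → {A : Ty} → {M : Tm Γ Δ A} → RedexOcc M → Tm Γ Δ A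
  | _, _, _, _, .beta P Q => P.subst Q
  | _, _, _, _, .mu P Q => .mu (P.msubst Q)
  | _, _, _, _, .rho α P => P.renMu α
  | _, _, _, _, .theta _ P _ => P
  | _, _, _, _, .inLam r => .lam r.contract
  | _, _, _, _, .inFn r N => .app r.contract N
  | _, _, _, _, .inArg M r => .app M r.contract
  | _, _, _, _, .inNamed α r => .named α r.contract
  | _, _, _, _, .inMu r => .mu r.contract

/-- The rank of a redex: the length of the type of its `λ`- or `μ`-abstraction. -/
def RedexOcc.rank : {Γ Δ : List Ty} → {A : Ty} → {M : Tm Γ Δ A} → RedexOcc M → ℕ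
  | _, _, _, _, .beta (A := A) (B := B) _ _ => (Ty.arr A B).lh
  | _, _, _, _, .mu (A := A) (B := B) _ _ => (Ty.arr A B).lh
  | _, _, _, _, .rho (A := A) _ _ => A.lh
  | _, _, _, _, .theta (A := A) _ _ _ => A.lh
  | _, _, _, _, .inLam r => r.rank
  | _, _, _, _, .inFn r _ => r.rank
  | _, _, _, _, .inArg _ r => r.rank
  | _, _, _, _, .inNamed _ r => r.rank
  | _, _, _, _, .inMu r => r.rank

/-- Auxiliary to `RedexOcc.m`: `c` is the complexity of the whole term, and `n` is the number of
arguments to which the current subterm is applied in the whole term. In the `theta` case the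
truncation of `2 * 0 - 1` to `0` is harmless, since only `max m 2` is ever used. -/
def RedexOcc.mAux : {Γ Δ : List Ty} → {A : Ty} → {M : Tm Γ Δ A} → (c n : ℕ) → RedexOcc M → ℕ
  | _, _, _, _, c, _, .beta _ _ => 2 * c - 2
  | _, _, _, _, _, _, .mu P _ => P.muCount 0
  | _, _, _, _, _, _, .rho _ _ => 1
  | _, _, _, _, _, n, .theta _ _ _ => 2 * n - 1
  | _, _, _, _, c, _, .inLam r => r.mAux c 0
  | _, _, _, _, c, n, .inFn r _ => r.mAux c (n + 1)
  | _, _, _, _, c, _, .inArg _ r => r.mAux c 0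
  | _, _, _, _, c, _, .inNamed _ r => r.mAux c 0
  | _, _, _, _, c, _, .inMu r => r.mAux c 0

/-- The number `m(R, M)`. -/
def RedexOcc.m {Γ Δ : List Ty} {A : Ty} {M : Tm Γ Δ A} (r : RedexOcc M) : ℕ :=
  r.mAux M.comp 0

/-- Directions in the syntax tree: into the body of `λ`, `μ` or `[α]`, or into the left or
the right part of an application. -/
inductive Dir : Type
  | body : Dir
  | fn : Dir
  | arg : Dir

/-- The position in the syntax tree of a redex occurrence. -/
def RedexOcc.pos : {Γ Δ : List Ty} → {A : Ty} → {M : Tm Γ Δ A} → RedexOcc M → List Dir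
  | _, _, _, _, .beta _ _ => []
  | _, _, _, _, .mu _ _ => []
  | _, _, _, _, .rho _ _ => []
  | _, _, _, _, .theta _ _ _ => []
  | _, _, _, _, .inLam r => .body :: r.pos
  | _, _, _, _, .inFn r _ => .fn :: r.pos
  | _, _, _, _, .inArg _ r => .arg :: r.pos
  | _, _, _, _, .inNamed _ r => .body :: r.pos
  | _, _, _, _, .inMu r => .body :: r.pos

/-- The redex `r` properly contains the redex `s`. -/
def RedexOcc.Contains {Γ Δ : List Ty} {A : Ty} {M : Tm Γ Δ A} (r s : RedexOcc M) : Prop :=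
  r.pos <+: s.pos ∧ r.pos ≠ s.pos

/-- The redex `r` is disjoint from the redex `s` and lies to the left of it. -/
def RedexOcc.LeftOf {Γ Δ : List Ty} {A : Ty} {M : Tm Γ Δ A} (r s : RedexOcc M) : Prop :=
  ∃ p u v : List Dir, r.pos = p ++ .fn :: u ∧ s.pos = p ++ .arg :: v

/-- The rank of a term: the maximum of the ranks of its redexes (`0` if there is none). -/
noncomputable def Tm.rank {Γ Δ : List Ty} {A : Ty} (M : Tm Γ Δ A) : ℕ :=
  sSup (Set.range fun r : RedexOcc M => r.rank)

/-- The supremum in `Tm.rank` is a genuine maximum. -/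
theorem bddAbove_rank {Γ Δ : List Ty} {A : Ty} (M : Tm Γ Δ A) :
    BddAbove (Set.range fun r : RedexOcc M => r.rank) := by
  suffices h : ∃ b, ∀ r : RedexOcc M, r.rank ≤ b by
    obtain ⟨b, hb⟩ := h
    exact ⟨b, by rintro _ ⟨r, rfl⟩; exact hb r⟩
  induction M with
  | var x => exact ⟨0, fun r => nomatch r⟩
  | lam M ih =>
    obtain ⟨b, hb⟩ := ih
    refine ⟨b, fun r => ?_⟩
    cases r with
    | inLam r => exact hb r
  | @app Γ Δ A B M N ihM ihN =>
    obtain ⟨b, hb⟩ := ihM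
    obtain ⟨c, hc⟩ := ihN
    refine ⟨max (Ty.arr A B).lh (max b c), fun r => ?_⟩
    cases r with
    | beta P Q => exact le_max_left _ _
    | mu P Q => exact le_max_left _ _
    | inFn r N => exact le_max_of_le_right (le_max_of_le_left (hb r))
    | inArg M r => exact le_max_of_le_right (le_max_of_le_right (hc r))
  | @named Γ Δ A α M ih =>
    obtain ⟨b, hb⟩ := ih
    refine ⟨max A.lh b, fun r => ?_⟩
    cases r with
    | rho α P => exact le_max_left _ _
    | inNamed α r => exact le_max_of_le_right (hb r)
  | @mu Γ Δ A M ih =>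
    obtain ⟨b, hb⟩ := ih
    refine ⟨max A.lh b, fun r => ?_⟩
    cases r with
    | theta U P h => exact le_max_left _ _
    | inMu r => exact le_max_of_le_right (hb r)

/-- Normal forms: terms without redexes. -/
def Tm.IsNormal {Γ Δ : List Ty} {A : Ty} (M : Tm Γ Δ A) : Prop :=
  IsEmpty (RedexOcc M)

/-- `r` has maximal rank and contains no other redex of maximal rank. -/
def RedexOcc.IsInnermostMax {Γ Δ : List Ty} {A : Ty} {M : Tm Γ Δ A} (r : RedexOcc M) : Prop :=
  r.rank = M.rank ∧ ∀ s : RedexOcc M, s.rank = M.rank → ¬ r.Contains s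

/-- `r` is the leftmost among the innermost redexes of maximal rank. -/
def RedexOcc.IsGood {Γ Δ : List Ty} {A : Ty} {M : Tm Γ Δ A} (r : RedexOcc M) : Prop :=
  r.IsInnermostMax ∧ ∀ s : RedexOcc M, s.IsInnermostMax → s.pos ≠ r.pos → r.LeftOf s

/-- Finite, possibly empty, reduction sequences from a term to a term. -/
inductive RedSeq {Γ Δ : List Ty} {A : Ty} : Tm Γ Δ A → Tm Γ Δ A → Type
  | nil (M : Tm Γ Δ A) : RedSeq M M
  | cons {M N : Tm Γ Δ A} (r : RedexOcc M) (σ : RedSeq r.contract N) : RedSeq M N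

/-- A reduction sequence is good if each step reduces the leftmost, innermost redex of
maximal rank. -/
def RedSeq.IsGood {Γ Δ : List Ty} {A : Ty} : {M N : Tm Γ Δ A} → RedSeq M N → Prop
  | _, _, .nil _ => True
  | _, _, .cons r σ => r.IsGood ∧ σ.IsGood

/-- The measure of a reduction sequence: the product of `1 + max (m(Rᵢ, Mᵢ)) 2` over its steps. -/
def RedSeq.measure {Γ Δ : List Ty} {A : Ty} : {M N : Tm Γ Δ A} → RedSeq M N → ℕ
  | _, _, .nil _ => 1
  | _, _, .cons r σ => (1 + max r.m 2) * σ.measure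

/-- `tower n m` is `2 ^ (2 ^ ... (2 ^ m))` with `n` twos. -/
def tower : ℕ → ℕ → ℕ
  | 0, m => m
  | n + 1, m => 2 ^ tower n m

end LambdaMu

namespace LambdaMu

/-! ### Bounds on the ranks of the `β`-, `μ`- and `ρ`-redexes -/

/-! The ranks are eliminated one at a time, from the top. A bound k on the ranks of the β-, μ- and
ρ-redexes survives every contraction (`RedexOcc.rankLE_contract`), because newly created redexes of
these kinds sit at types that are no longer than those already allowed. θ-redexes stay outside this
invariant: one can appear at any rank when a contraction erases the last inner occurrence of its
variable.

The main tool is `Tm.weight k`, which computes in advance the effect of firing all redexes of rank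
k, by carrying the weight of each argument to the places where it will be copied. It dominates the
complexity, and contracting a redex of rank k, or a θ-redex of higher rank, lowers it by at least 2
(`RedexOcc.weight_contract_add_two_le`). A good step contracts a redex of maximal rank, so the
weight falls by 2 as long as some redex has rank at least k, and each such step costs a factor of at
most 2 * comp - 1. Once only smaller ranks remain, the complexity is still bounded by the initial
weight and the bound for the previous rank applies (`RedSeq.IsGood.measure_le`). The weight is at
most exponential in the complexity (`Tm.weight_le`), which adds one exponential per rank.

At rank 0 the weight is the complexity, and every factor is 3 < 2 ^ 2. From rank 2 on, the previous
tower T absorbs the factors: (2n + 3) T(n) ≤ T(n + 2). Rank 1 is delicate, since T(n) = 2 ^ n does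
not absorb them. There the steps at ranks 0 and 1 are both charged 2s - 1, which gives `stepProd`,
about (n + 1) ^ (n / 2). The crude weight bound n ≤ 2 ^ c would then be insufficient; the sharper n
≤ (8/5) ^ (c + 1) - 3/2 suffices. -/

/-- The term is a `λ`-abstraction. -/
def Tm.IsLam : {Γ Δ : List Ty} → {A : Ty} → Tm Γ Δ A → Prop
  | _, _, _, .lam _ => True
  | _, _, _, _ => False

/-- The term is a `μ`-abstraction. -/
def Tm.IsMu : {Γ Δ : List Ty} → {A : Ty} → Tm Γ Δ A → Prop
  | _, _, _, .mu _ => True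
  | _, _, _, _ => False

/-- All `β`-, `μ`- and `ρ`-redexes of the term have rank at most `k`. There is no condition on
`θ`-redexes, which may be created by a reduction at any rank. -/
def Tm.RankLE (k : ℕ) : {Γ Δ : List Ty} → {A : Ty} → Tm Γ Δ A → Prop
  | _, _, _, .var _ => True
  | _, _, _, .lam M => M.RankLE k
  | _, _, _, .app (A := A) (B := B) M N =>
      M.RankLE k ∧ N.RankLE k ∧ (M.IsLam ∨ M.IsMu → (Ty.arr A B).lh ≤ k)
  | _, _, _, .named (A := A) _ M => M.RankLE k ∧ (M.IsMu → A.lh ≤ k)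
  | _, _, _, .mu M => M.RankLE k

theorem Tm.rankLE_of_forall_rank_le {k : ℕ} {Γ Δ : List Ty} {A : Ty} (M : Tm Γ Δ A)
    (h : ∀ r : RedexOcc M, r.rank ≤ k) : M.RankLE k := by
  induction M with
  | var x => trivial
  | lam M ih => exact ih fun r => h (.inLam r)
  | app M N ihM ihN =>
    refine ⟨ihM fun r => h (.inFn r N), ihN fun r => h (.inArg M r), fun hM => ?_⟩
    cases M with
    | lam P => exact h (.beta P N)
    | mu P => exact h (.mu P N)
    | var x => simp [IsLam, IsMu] at hM
    | app P Q => simp [IsLam, IsMu] at hM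
  | named α M ih =>
    refine ⟨ih fun r => h (.inNamed α r), fun hM => ?_⟩
    cases M with
    | mu P => exact h (.rho α P)
    | lam P => simp [IsMu] at hM
    | var x => simp [IsMu] at hM
    | app P Q => simp [IsMu] at hM
    | named β P => simp [IsMu] at hM
  | mu M ih => exact ih fun r => h (.inMu r)

theorem Tm.isLam_ren {Γ Γ' Δ Δ' : List Ty} {A : Ty} (f : Ren Γ Γ') (g : Ren Δ Δ')
    (M : Tm Γ Δ A) : (M.ren f g).IsLam ↔ M.IsLam := by
  cases M <;> rfl

theorem Tm.isMu_ren {Γ Γ' Δ Δ' : List Ty} {A : Ty} (f : Ren Γ Γ') (g : Ren Δ Δ')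
    (M : Tm Γ Δ A) : (M.ren f g).IsMu ↔ M.IsMu := by
  cases M <;> rfl

theorem Tm.rankLE_ren {k : ℕ} {Γ Γ' Δ Δ' : List Ty} {A : Ty} (f : Ren Γ Γ') (g : Ren Δ Δ')
    (M : Tm Γ Δ A) : (M.ren f g).RankLE k ↔ M.RankLE k := by
  induction M generalizing Γ' Δ' with
  | var x => rfl
  | lam M ih => exact ih _ _
  | app M N ihM ihN => simp only [ren, RankLE, ihM, ihN, isLam_ren, isMu_ren]
  | named α M ih => simp only [ren, RankLE, ih, isMu_ren]
  | mu M ih => exact ih _ _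

/-- New redexes arise only where a variable in function position or directly under a name is
replaced by an abstraction. Their rank is the length of the type of that variable, which `hs`
bounds. -/
theorem Tm.RankLE.sub {k : ℕ} {Γ Γ' Δ : List Ty} {A : Ty} {M : Tm Γ Δ A} (hM : M.RankLE k)
    {s : Sub Γ Γ' Δ}
    (hs : ∀ B i, (s B i).RankLE k ∧ ((s B i).IsLam ∨ (s B i).IsMu → B.lh ≤ k)) :
    (M.sub s).RankLE k := by
  induction M generalizing Γ' with
  | var x => exact (hs _ x).1
  | lam M ih =>
    refine ih hM fun B i => ?_
    cases i with
    | zero => simp [Sub.liftLam, RankLE, IsLam, IsMu]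
    | succ i => simpa [Sub.liftLam, wkLam, rankLE_ren, isLam_ren, isMu_ren] using hs B i
  | app M N ihM ihN =>
    refine ⟨ihM hM.1 hs, ihN hM.2.1 hs, fun h => ?_⟩
    cases M with
    | var x => exact (hs _ x).2 h
    | lam P => exact hM.2.2 (.inl trivial)
    | mu P => exact hM.2.2 (.inr trivial)
    | app P Q => simp [Tm.sub, IsLam, IsMu] at h
  | named α M ih =>
    refine ⟨ih hM.1 hs, fun h => ?_⟩
    cases M with
    | var x => exact (hs _ x).2 (.inr h)
    | mu P => exact hM.2 trivial
    | lam P => simp [Tm.sub, IsMu] at h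
    | app P Q => simp [Tm.sub, IsMu] at h
    | named β P => simp [Tm.sub, IsMu] at h
  | mu M ih =>
    refine ih hM fun B i => ?_
    simpa [Sub.liftMu, wkMu, rankLE_ren, isLam_ren, isMu_ren] using hs B i

/-- The condition on a `Name` under which plugging it in preserves `Tm.RankLE k`. -/
def Name.RankLE (k : ℕ) {Γ Δ : List Ty} : {A : Ty} → Name Γ Δ A → Prop
  | _, .var _ => True
  | _, .arg (A := A) (B := B) _ N => N.RankLE k ∧ (Ty.arr A B).lh ≤ k

theorem Name.rankLE_ren {k : ℕ} {Γ Γ' Δ Δ' : List Ty} {A : Ty} (f : Ren Γ Γ') (g : Ren Δ Δ')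
    (a : Name Γ Δ A) : (a.ren f g).RankLE k ↔ a.RankLE k := by
  cases a with
  | var β => rfl
  | arg β N => simp only [ren, RankLE, Tm.rankLE_ren]

theorem Tm.isLam_msub {Γ Δ Δ' : List Ty} {A : Ty} (s : MSub Γ Δ Δ') (M : Tm Γ Δ A) :
    (M.msub s).IsLam ↔ M.IsLam := by
  cases M with
  | named α M => simp only [msub]; generalize s _ α = a; cases a <;> rfl
  | _ => rfl

theorem Tm.isMu_msub {Γ Δ Δ' : List Ty} {A : Ty} (s : MSub Γ Δ Δ') (M : Tm Γ Δ A) :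
    (M.msub s).IsMu ↔ M.IsMu := by
  cases M with
  | named α M => simp only [msub]; generalize s _ α = a; cases a <;> rfl
  | _ => rfl

/-- Replacing [α] U by [β] (U N) may create a redex U N, whose rank is bounded by `Name.RankLE`. It
creates no ρ-redex, as an application stands under the name. -/
theorem Tm.RankLE.msub {k : ℕ} {Γ Δ Δ' : List Ty} {A : Ty} {M : Tm Γ Δ A} (hM : M.RankLE k)
    {s : MSub Γ Δ Δ'} (hs : ∀ B i, (s B i).RankLE k) : (M.msub s).RankLE k := by
  induction M generalizing Δ' with
  | var x => trivial
  | lam M ih => exact ih hM fun B i => (Name.rankLE_ren _ _ _).2 (hs B i)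
  | app M N ihM ihN =>
    refine ⟨ihM hM.1 hs, ihN hM.2.1 hs, fun h => hM.2.2 ?_⟩
    simpa only [isLam_msub, isMu_msub] using h
  | named α M ih =>
    have h1 := ih hM.1 hs
    have h2 := isMu_msub s M
    have h3 := hs _ α
    simp only [Tm.msub]
    generalize s _ α = a at h3
    cases a with
    | var β => exact ⟨h1, fun h => hM.2 (h2.1 h)⟩
    | arg β N => exact ⟨⟨h1, h3.1, fun _ => h3.2⟩, False.elim⟩
  | mu M ih =>
    refine ih hM fun B i => ?_
    cases i with
    | zero => trivial
    | succ i => exact (Name.rankLE_ren _ _ _).2 (hs B i)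

theorem RedexOcc.isMu_of_isMu_contract {k : ℕ} {Γ Δ : List Ty} {A : Ty} {M : Tm Γ Δ A}
    (r : RedexOcc M) (hM : M.RankLE k) (h : r.contract.IsMu) : M.IsMu ∨ A.lh ≤ k := by
  cases r with
  | beta P Q =>
    have := hM.2.2 (.inl trivial)
    simp only [Ty.lh] at this
    exact .inr (by omega)
  | mu P Q =>
    have := hM.2.2 (.inr trivial)
    simp only [Ty.lh] at this
    exact .inr (by omega)
  | rho α P => exact .inr (Nat.zero_le k)
  | theta U P h => exact .inl trivial
  | inMu r => exact .inl trivial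
  | _ => exact h.elim

/-- Controls redexes created around the contracted one. If the contractum is a new abstraction, then
its type is the codomain of the contracted β- or μ-redex, or ⊥ after a ρ-step. -/
theorem RedexOcc.isLam_or_isMu_of_contract {k : ℕ} {Γ Δ : List Ty} {A : Ty} {M : Tm Γ Δ A}
    (r : RedexOcc M) (hM : M.RankLE k) (h : r.contract.IsLam ∨ r.contract.IsMu) :
    (M.IsLam ∨ M.IsMu) ∨ A.lh ≤ k := by
  cases r with
  | beta P Q =>
    have := hM.2.2 (.inl trivial)
    simp only [Ty.lh] at this
    exact .inr (by omega)
  | mu P Q =>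
    have := hM.2.2 (.inr trivial)
    simp only [Ty.lh] at this
    exact .inr (by omega)
  | rho α P => exact .inr (Nat.zero_le k)
  | theta U P h => exact .inl (.inr trivial)
  | inLam r => exact .inl (.inl trivial)
  | inMu r => exact .inl (.inr trivial)
  | _ => exact (h.elim id id).elim

theorem RedexOcc.rankLE_contract {k : ℕ} {Γ Δ : List Ty} {A : Ty} {M : Tm Γ Δ A}
    (r : RedexOcc M) (hM : M.RankLE k) : r.contract.RankLE k := by
  induction r with
  | @beta Γ Δ A B P Q =>
    have hk := hM.2.2 (.inl trivial)
    simp only [Ty.lh] at hk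
    refine Tm.RankLE.sub (M := P) hM.1 fun C i => ?_
    cases i with
    | zero => exact ⟨hM.2.1, fun _ => by omega⟩
    | succ i => exact ⟨trivial, fun h => (h.elim id id).elim⟩
  | mu P Q =>
    refine Tm.RankLE.msub (M := P) hM.1 fun C i => ?_
    cases i with
    | zero => exact ⟨(Tm.rankLE_ren _ _ _).2 hM.2.1, hM.2.2 (.inr trivial)⟩
    | succ i => trivial
  | rho α P => exact (Tm.rankLE_ren _ _ P).2 hM.1
  | theta U P h =>
    subst h
    exact (Tm.rankLE_ren _ _ P).1 hM.1
  | inLam r ih => exact ih hM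
  | inFn r N ih =>
    exact ⟨ih hM.1, hM.2.1, fun h => (r.isLam_or_isMu_of_contract hM.1 h).elim hM.2.2 id⟩
  | inArg M r ih => exact ⟨hM.1, ih hM.2.1, hM.2.2⟩
  | inNamed α r ih => exact ⟨ih hM.1, fun h => (r.isMu_of_isMu_contract hM.1 h).elim hM.2 id⟩
  | inMu r ih => exact ih hM

/-! ### The weight of a term -/

/-- An assignment of natural numbers to the variables of a context. -/
abbrev Val (Γ : List Ty) : Type := ∀ A : Ty, Idx Γ A → ℕ

/-- The extension of an assignment to a fresh variable. -/
def Val.cons {Γ : List Ty} {B : Ty} (n : ℕ) (v : Val Γ) : Val (B :: Γ)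
  | _, .zero => n
  | _, .succ i => v _ i

/-- An upper bound for the complexity of the terms, and for twice the number of steps, that
contractions of redexes of rank `k` lead to. Here `v` gives the weights of the terms that are to
be substituted for the `λ`-variables, `a` those of the arguments that are to be supplied to the
subterms `[α] U`, and `q` that of the argument to which the term itself is applied, if the redex
formed with it has rank `k`; `0` stands for the absence of an argument. -/
def Tm.weight (k : ℕ) : {Γ Δ : List Ty} → {A : Ty} → Tm Γ Δ A → Val Γ → Val Δ → ℕ → ℕ
  | _, _, _, .var x, v, _, q => v _ x + q
  -- A bound variable without a supplied argument still counts 1, as in the complexity.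
  | _, _, _, .lam M, v, a, q => M.weight k (v.cons (max q 1)) a 0 + 1 + q
  | _, _, _, .app (A := A) (B := B) M N, v, a, q =>
      if (Ty.arr A B).lh = k then M.weight k v a (N.weight k v a 0) + q
      else M.weight k v a 0 + N.weight k v a 0 + q
  | _, _, _, .named α M, v, a, q => M.weight k v a (a _ α) + 1 + q
  | _, _, _, .mu M, v, a, q => M.weight k v (a.cons q) 0 + 1 + q + min q 1

-- The assignment seen through a lifted renaming is again an extension, which lets the weight be
-- computed below binders.
theorem Val.cons_lift {Γ Γ' : List Ty} {B : Ty} (n : ℕ) (v : Val Γ') (f : Ren Γ Γ') :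
    (fun A i => (Val.cons (B := B) n v) A (f.lift B A i)) = Val.cons n fun A i => v A (f A i) := by
  funext A i
  cases i <;> rfl

theorem Val.cons_mono {Γ : List Ty} {B : Ty} {n n' : ℕ} {v v' : Val Γ} (hn : n ≤ n')
    (hv : ∀ A i, v A i ≤ v' A i) : ∀ A i, Val.cons (B := B) n v A i ≤ Val.cons n' v' A i
  | _, .zero => hn
  | _, .succ i => hv _ i

theorem Tm.weight_ren (k : ℕ) {Γ Γ' Δ Δ' : List Ty} {A : Ty} (f : Ren Γ Γ') (g : Ren Δ Δ')
    (M : Tm Γ Δ A) (v : Val Γ') (a : Val Δ') (q : ℕ) :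
    (M.ren f g).weight k v a q =
      M.weight k (fun A i => v A (f A i)) (fun A i => a A (g A i)) q := by
  induction M generalizing Γ' Δ' q with
  | var x => rfl
  | lam M ih => simp only [ren, weight, ih, Val.cons_lift]
  | app M N ihM ihN => simp only [ren, weight, ihM, ihN]
  | named α M ih => simp only [ren, weight, ih]
  | mu M ih => simp only [ren, weight, ih, Val.cons_lift]

/-- Every clause contains q as an explicit summand and is otherwise monotone. Growth at rate at
least 1 in q ensures that a decrease in the weight of an argument is never lost in the surrounding
application. -/
theorem Tm.weight_add_le (k : ℕ) {Γ Δ : List Ty} {A : Ty} (M : Tm Γ Δ A) {v v' : Val Γ}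
    {a a' : Val Δ} (hv : ∀ B i, v B i ≤ v' B i) (ha : ∀ B i, a B i ≤ a' B i) (q d : ℕ) :
    M.weight k v a q + d ≤ M.weight k v' a' (q + d) := by
  induction M generalizing q d with
  | var x => have := hv _ x; simp only [weight]; omega
  | lam M ih =>
    have := ih (Val.cons_mono (by omega : max q 1 ≤ max (q + d) 1) hv) ha 0 0
    simp only [weight, Nat.add_zero] at this ⊢
    omega
  | app M N ihM ihN =>
    have hN := ihN hv ha 0 0
    simp only [weight, Nat.add_zero] at hN ⊢
    split_ifs
    · obtain ⟨e, he⟩ := Nat.exists_eq_add_of_le hN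
      have := ihM hv ha (N.weight k v a 0) e
      rw [he]
      omega
    · have := ihM hv ha 0 0
      simp only [Nat.add_zero] at this
      omega
  | named α M ih =>
    obtain ⟨e, he⟩ := Nat.exists_eq_add_of_le (ha _ α)
    have := ih hv ha (a _ α) e
    simp only [weight]
    rw [he]
    omega
  | mu M ih =>
    have := ih hv (Val.cons_mono (Nat.le_add_right q d) ha) 0 0
    simp only [weight, Nat.add_zero] at this ⊢
    omega

theorem Tm.weight_add_sub_le (k : ℕ) {Γ Δ : List Ty} {A : Ty} (M : Tm Γ Δ A) (v : Val Γ)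
    (a : Val Δ) {q q' : ℕ} (h : q ≤ q') : M.weight k v a q + (q' - q) ≤ M.weight k v a q' := by
  have := M.weight_add_le k (fun B i => le_refl (v B i)) (fun B i => le_refl (a B i)) q (q' - q)
  rwa [Nat.add_sub_cancel' h] at this

theorem Tm.one_le_comp {Γ Δ : List Ty} {A : Ty} (M : Tm Γ Δ A) : 1 ≤ M.comp := by
  induction M <;> simp only [comp] <;> omega

theorem Val.one_le_cons {Γ : List Ty} {B : Ty} {n : ℕ} {v : Val Γ} (hn : 1 ≤ n)
    (hv : ∀ A i, 1 ≤ v A i) : ∀ A i, 1 ≤ Val.cons (B := B) n v A i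
  | _, .zero => hn
  | _, .succ i => hv _ i

theorem Tm.comp_add_le_weight (k : ℕ) {Γ Δ : List Ty} {A : Ty} (M : Tm Γ Δ A) {v : Val Γ}
    (hv : ∀ B i, 1 ≤ v B i) (a : Val Δ) (q : ℕ) : M.comp + q ≤ M.weight k v a q := by
  induction M generalizing q with
  | var x => have := hv _ x; simp only [weight, comp]; omega
  | lam M ih =>
    have := ih (Val.one_le_cons (le_max_right q 1) hv) a 0
    simp only [weight, comp]
    omega
  | app M N ihM ihN =>
    have hN := ihN hv a 0
    have hM := ihM hv a 0
    have hM' := ihM hv a (N.weight k v a 0)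
    simp only [weight, comp]
    split_ifs <;> omega
  | named α M ih => have := ih hv a (a _ α); simp only [weight, comp]; omega
  | mu M ih => have := ih hv (a.cons q) 0; simp only [weight, comp]; omega

/-- Arguments of a nonzero weight `q` are supplied only to terms whose type has length `k`. -/
def ArgAdm (k : ℕ) (A : Ty) (q : ℕ) : Prop :=
  q = 0 ∨ A.lh = k ∧ 0 < k

theorem ArgAdm.zero {k : ℕ} {A : Ty} : ArgAdm k A 0 := .inl rfl

theorem ArgAdm.arr {k q : ℕ} {A B : Ty} (h : (Ty.arr A B).lh = k) : ArgAdm k (Ty.arr A B) q :=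
  .inr ⟨h, h ▸ Nat.succ_pos _⟩

theorem ArgAdm.eq_zero {k q : ℕ} {A : Ty} (h : ArgAdm k A q) (hA : A.lh < k ∨ A = .bot) : q = 0 := by
  refine h.resolve_right fun ⟨h1, h2⟩ => ?_
  rcases hA with hA | rfl
  · omega
  · simp only [Ty.lh] at h1
    omega

theorem Val.cons_adm {k : ℕ} {Γ : List Ty} {B : Ty} {n : ℕ} {v : Val Γ} (hn : ArgAdm k B n)
    (hv : ∀ A i, ArgAdm k A (v A i)) :
    ∀ A i, ArgAdm k A (Val.cons (B := B) n v A i)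
  | _, .zero => hn
  | _, .succ i => hv _ i

/-- The hypothesis on s is restricted to admissible p. An abstraction may weigh more than its weight
at 0 plus p, but the term substituted in a rank-k β-step has a type shorter than k, which forces p =
0. -/
theorem Tm.weight_sub_le (k : ℕ) {Γ Γ' Δ : List Ty} {A : Ty} (M : Tm Γ Δ A) {s : Sub Γ Γ' Δ}
    {v : Val Γ} {v' : Val Γ'} {a : Val Δ} {q : ℕ} (ha : ∀ B i, ArgAdm k B (a B i))
    (hq : ArgAdm k A q)
    (hs : ∀ B i p, ArgAdm k B p → (s B i).weight k v' a p ≤ v B i + p) :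
    (M.sub s).weight k v' a q ≤ M.weight k v a q := by
  induction M generalizing Γ' q with
  | var x => exact hs _ x q hq
  | lam M ih =>
    have := ih (s := s.liftLam _) (v := v.cons (max q 1)) (v' := v'.cons (max q 1)) (q := 0) ha
      .zero fun B i p hp => by
        cases i with
        | zero => exact le_rfl
        | succ i => exact (weight_ren _ _ _ _ _ _ _).trans_le (hs B i p hp)
    simp only [Tm.sub, weight]
    omega
  | app M N ihM ihN =>
    have hN := ihN ha .zero hs
    have hM := ihM ha .zero hs
    simp only [Tm.sub, weight]
    split_ifs with hk
    · have h1 := ihM (q := (N.sub s).weight k v' a 0) ha (.arr hk) hs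
      have h2 := M.weight_add_sub_le k v a hN
      omega
    · omega
  | named α M ih =>
    have := ih ha (ha _ α) hs
    simp only [Tm.sub, weight]
    omega
  | mu M ih =>
    have := ih (s := s.liftMu _) (v := v) (v' := v') (a := a.cons q) (q := 0)
      (Val.cons_adm hq ha) .zero fun B i p hp => by
        exact (weight_ren _ _ _ _ _ _ _).trans_le (hs B i p hp)
    simp only [Tm.sub, weight]
    omega

/-- The `Name` supplies arguments of weight at most `n` to the subterms that it replaces. -/
def Name.WeightLE (k : ℕ) {Γ Δ : List Ty} (v : Val Γ) (a : Val Δ) (n : ℕ) :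
    {A : Ty} → Name Γ Δ A → Prop
  | _, .var β => a _ β ≤ n
  | _, .arg (A := A) (B := B) β N => (Ty.arr A B).lh = k ∧ N.weight k v a 0 + a _ β ≤ n

theorem Name.weightLE_ren {k : ℕ} {Γ Γ' Δ Δ' : List Ty} {A : Ty} (f : Ren Γ Γ') (g : Ren Δ Δ')
    (v : Val Γ') (a : Val Δ') (n : ℕ) (b : Name Γ Δ A) :
    (b.ren f g).WeightLE k v a n ↔
      b.WeightLE k (fun A i => v A (f A i)) (fun A i => a A (g A i)) n := by
  cases b with
  | var β => rfl
  | arg β N => simp only [ren, WeightLE, Tm.weight_ren]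

/-- The weight of [α] U already treats U as applied to an argument of weight `a _ α`. After
plugging, U receives N itself, and growth at rate at least 1 in the argument pays for what remains
to be supplied to β. -/
theorem Tm.weight_msub_le (k : ℕ) {Γ Δ Δ' : List Ty} {A : Ty} (M : Tm Γ Δ A) {s : MSub Γ Δ Δ'}
    {v : Val Γ} {a : Val Δ} {a' : Val Δ'} (q : ℕ) (hs : ∀ B i, (s B i).WeightLE k v a' (a B i)) :
    (M.msub s).weight k v a' q ≤ M.weight k v a q := by
  induction M generalizing Δ' q with
  | var x => exact le_rfl
  | lam M ih =>
    have := ih (s := s.liftLam _) (v := v.cons (max q 1)) (a := a) (a' := a') 0 fun B i =>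
      (Name.weightLE_ren _ _ _ _ _ _).2 (hs B i)
    simp only [Tm.msub, weight]
    omega
  | app M N ihM ihN =>
    have hN := ihN 0 hs
    have hM := ihM 0 hs
    simp only [Tm.msub, weight]
    split_ifs with hk
    · have h1 := ihM ((N.msub s).weight k v a' 0) hs
      have h2 := M.weight_add_sub_le k v a hN
      omega
    · omega
  | named α M ih =>
    have h1 := fun p => ih (s := s) (v := v) (a := a) (a' := a') p hs
    have h2 := fun p => M.weight_add_sub_le k v a (q := p) (q' := a _ α)
    have h3 := hs _ α
    simp only [Tm.msub, weight]
    generalize s _ α = b at h3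
    cases b with
    | var β =>
      have := h1 (a' _ β)
      have := h2 _ h3
      simp only [Name.plug, weight]
      omega
    | arg β N =>
      obtain ⟨hk, hN⟩ := h3
      have := h1 (N.weight k v a' 0)
      have := h2 (N.weight k v a' 0) (by omega)
      simp only [Name.plug, weight, if_pos hk]
      omega
  | mu M ih =>
    have := ih (s := s.liftMu _) (v := v) (a := a.cons q) (a' := a'.cons q) 0 fun B i => by
      cases i with
      | zero => exact le_rfl
      | succ i => exact (Name.weightLE_ren _ _ _ _ _ _).2 (hs B i)
    simp only [Tm.msub, weight]
    omega

/-- The contraction of a redex of maximal rank `k`, or of a `θ`-redex of higher rank, decreases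
the weight by at least `2`. -/
theorem RedexOcc.weight_contract_add_two_le {k : ℕ} {Γ Δ : List Ty} {A : Ty} {M : Tm Γ Δ A}
    (r : RedexOcc M) (hM : M.RankLE k) (hr : k ≤ r.rank) {v : Val Γ} {a : Val Δ} {q : ℕ}
    (hv : ∀ B i, 1 ≤ v B i) (ha : ∀ B i, ArgAdm k B (a B i)) (hq : ArgAdm k A q) :
    r.contract.weight k v a q + 2 ≤ M.weight k v a q := by
  induction r generalizing q with
  | @beta Γ Δ A B P Q =>
    have hk : (Ty.arr A B).lh = k := le_antisymm (hM.2.2 (.inl trivial)) hr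
    have hk' := hk
    simp only [Ty.lh] at hk'
    -- The contractum has a type shorter than k, so no argument is supplied to it at rank k.
    obtain rfl : q = 0 := hq.eq_zero (.inl (by omega))
    have hQ := Q.comp_add_le_weight k hv a 0
    have hQ1 := Q.one_le_comp
    have := P.weight_sub_le k (s := Sub.single Q)
      (v := v.cons (max (Q.weight k v a 0) 1)) (v' := v) (q := 0) ha .zero fun C i p hp => by
        cases i with
        | zero =>
          obtain rfl : p = 0 := hp.eq_zero (.inl (by omega))
          exact le_max_left _ _
        | succ i => exact le_rfl
    simp only [contract, Tm.subst, Tm.weight, if_pos hk]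
    omega
  | @mu Γ Δ A B P Q =>
    have hk : (Ty.arr A B).lh = k := le_antisymm (hM.2.2 (.inr trivial)) hr
    have hk' := hk
    simp only [Ty.lh] at hk'
    obtain rfl : q = 0 := hq.eq_zero (.inl (by omega))
    have hQ := Q.comp_add_le_weight k hv a 0
    have hQ1 := Q.one_le_comp
    have := P.weight_msub_le k (s := MSub.single Q) (v := v)
      (a := a.cons (Q.weight k v a 0)) (a' := a.cons 0) 0 fun C i => by
        cases i with
        | zero =>
          refine ⟨hk, ?_⟩
          rw [Tm.wkMu, Tm.weight_ren]
          exact le_rfl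
        | succ i => exact le_rfl
    simp only [contract, Tm.msubst, Tm.weight, if_pos hk]
    -- The summand `min q 1` of the μ-clause matters here: if Q has weight 1, the decrease would
    -- otherwise be only 1.
    omega
  | @rho Γ Δ A α P =>
    have h : (fun B i => a B (Ren.single α B i)) = a.cons (a _ α) := by
      funext B i
      cases i <;> rfl
    obtain rfl : q = 0 := hq.eq_zero (.inr rfl)
    have : (P.renMu α).weight k v a 0 = P.weight k v (a.cons (a _ α)) 0 :=
      (P.weight_ren k (fun _ i => i) (Ren.single α) v a 0).trans (by rw [h])
    simp only [contract, Tm.weight, this]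
    omega
  | theta U P h =>
    have : U.weight k v (a.cons q) q = P.weight k v a q := by
      rw [← h]
      exact P.weight_ren ..
    simp only [contract, Tm.weight, Val.cons, this]
    omega
  | inLam r ih =>
    have := ih hM hr (Val.one_le_cons (le_max_right q 1) hv) ha .zero
    simp only [contract, Tm.weight]
    omega
  | @inFn Γ Δ A B M r N ih =>
    simp only [contract, Tm.weight]
    split_ifs with hk
    · have := ih hM.1 hr hv ha (q := N.weight k v a 0) (.arr hk)
      omega
    · have := ih hM.1 hr hv ha .zero
      omega
  | @inArg Γ Δ A B M N r ih =>
    have := ih hM.2.1 hr hv ha .zero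
    simp only [contract, Tm.weight]
    split_ifs with hk
    · have := M.weight_add_sub_le k v a (by omega : r.contract.weight k v a 0 ≤ N.weight k v a 0)
      omega
    · omega
  | inNamed α r ih =>
    have := ih hM.1 hr hv ha (ha _ α)
    simp only [contract, Tm.weight]
    omega
  | inMu r ih =>
    have := ih hM hr hv (Val.cons_adm hq ha) .zero
    simp only [contract, Tm.weight]
    omega

/-- An arrow type has length at least 1, so at k = 0 no application passes its argument on. -/
theorem Tm.weight_zero {Γ Δ : List Ty} {A : Ty} (M : Tm Γ Δ A) {v : Val Γ} {a : Val Δ}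
    (hv : ∀ B i, v B i = 1) (ha : ∀ B i, a B i = 0) : M.weight 0 v a 0 = M.comp := by
  induction M with
  | var x => simp only [weight, comp, hv]
  | lam M ih =>
    simp only [weight, comp]
    rw [ih (fun B i => by cases i <;> simp [Val.cons, hv]) ha]
  | app M N ihM ihN =>
    have h : ∀ A B, (Ty.arr A B).lh ≠ 0 := fun A B => by simp [Ty.lh]
    simp only [weight, comp, if_neg (h _ _), ihM hv ha, ihN hv ha, Nat.add_zero]
  | named α M ih => simp only [weight, comp, ha, ih hv ha, Nat.add_zero]
  | mu M ih =>
    simp only [weight, comp]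
    rw [ih hv (fun B i => by cases i <;> simp [Val.cons, ha])]
    rfl

/-! ### The cost of a step -/

theorem Tm.muCount_le_comp {Γ Δ : List Ty} {A : Ty} (M : Tm Γ Δ A) (n : ℕ) :
    M.muCount n ≤ M.comp := by
  induction M generalizing n with
  | var x => exact Nat.zero_le _
  | lam M ih => have := ih n; simp only [muCount, comp]; omega
  | app M N ihM ihN => have := ihM n; have := ihN n; simp only [muCount, comp]; omega
  | named α M ih => have := ih n; simp only [muCount, comp]; split_ifs <;> omega
  | mu M ih => have := ih (n + 1); simp only [muCount, comp]; omega

theorem RedexOcc.three_le_comp {Γ Δ : List Ty} {A : Ty} {M : Tm Γ Δ A} (r : RedexOcc M) :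
    3 ≤ M.comp := by
  induction r with
  | beta P Q => have := P.one_le_comp; have := Q.one_le_comp; simp only [Tm.comp]; omega
  | mu P Q => have := P.one_le_comp; have := Q.one_le_comp; simp only [Tm.comp]; omega
  | rho α P => have := P.one_le_comp; simp only [Tm.comp]; omega
  | theta U P h => have := U.one_le_comp; simp only [Tm.comp]; omega
  | _ => simp only [Tm.comp]; omega

/-- Each of the n arguments around the current subterm has complexity at least 1, so the sum with n
stays below the complexity c of the whole term. -/
theorem RedexOcc.mAux_le {Γ Δ : List Ty} {A : Ty} {M : Tm Γ Δ A} (r : RedexOcc M) {c n : ℕ}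
    (h : M.comp + n ≤ c) : r.mAux c n ≤ 2 * c - 2 := by
  have h3 := r.three_le_comp
  induction r generalizing n with
  | beta P Q => exact le_rfl
  | mu P Q =>
    have := P.muCount_le_comp 0
    simp only [Tm.comp] at h
    simp only [mAux]
    omega
  | rho α P => simp only [mAux]; omega
  | theta U P hP => simp only [mAux]; omega
  | inFn r N ih =>
    have := N.one_le_comp
    simp only [Tm.comp] at h
    exact ih (by omega) r.three_le_comp
  | _ =>
    rename_i r ih
    simp only [Tm.comp] at h
    exact ih (by omega) r.three_le_comp

theorem RedexOcc.one_add_max_m_le {Γ Δ : List Ty} {A : Ty} {M : Tm Γ Δ A} (r : RedexOcc M) :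
    1 + max r.m 2 ≤ 2 * M.comp - 1 := by
  have h1 := r.three_le_comp
  have h2 : r.m ≤ 2 * M.comp - 2 := r.mAux_le le_rfl
  omega

/-- β- and μ-redexes have positive rank, and a θ-redex with an argument is the head of a μ-redex.
Only ρ-redexes and θ-redexes without arguments remain. -/
theorem RedexOcc.mAux_le_two {Γ Δ : List Ty} {A : Ty} {M : Tm Γ Δ A} (r : RedexOcc M)
    (hM : M.RankLE 0) (c : ℕ) {n : ℕ} (hn : n = 0 ∨ ¬ M.IsMu) : r.mAux c n ≤ 2 := by
  induction r generalizing n with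
  | beta P Q => have := hM.2.2 (.inl trivial); simp [Ty.lh] at this
  | mu P Q => have := hM.2.2 (.inr trivial); simp [Ty.lh] at this
  | rho α P => simp only [mAux]; omega
  | theta U P h =>
    obtain rfl : n = 0 := hn.resolve_right fun h => h trivial
    simp [mAux]
  | inLam r ih => exact ih hM (.inl rfl)
  | inFn r N ih =>
    refine ih hM.1 (.inr fun h => ?_)
    have := hM.2.2 (.inr h)
    simp [Ty.lh] at this
  | inArg M r ih => exact ih hM.2.1 (.inl rfl)
  | inNamed α r ih => exact ih hM.1 (.inl rfl)
  | inMu r ih => exact ih hM (.inl rfl)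

/-! ### The upper bound for the weight -/

theorem Tm.weight_of_not_isLam_of_not_isMu (k : ℕ) {Γ Δ : List Ty} {A : Ty} (M : Tm Γ Δ A)
    (hl : ¬ M.IsLam) (hm : ¬ M.IsMu) (v : Val Γ) (a : Val Δ) (q : ℕ) :
    M.weight k v a q = M.weight k v a 0 + q := by
  cases M with
  | lam M => exact (hl trivial).elim
  | mu M => exact (hm trivial).elim
  | app M N => simp only [weight]; split_ifs <;> rfl
  | _ => rfl

theorem Val.cons_cast_le {Γ : List Ty} {B : Ty} {n : ℕ} {v : Val Γ} {W : ℝ} (hn : (n : ℝ) ≤ W)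
    (hv : ∀ A i, (v A i : ℝ) ≤ W) : ∀ A i, (Val.cons (B := B) n v A i : ℝ) ≤ W
  | _, .zero => hn
  | _, .succ i => hv _ i

theorem le_eight_fifths_pow {c : ℕ} (hc : 1 ≤ c) : (64 / 25 : ℝ) ≤ (8 / 5) ^ (c + 1) :=
  calc (64 / 25 : ℝ) = (8 / 5) ^ 2 := by norm_num
    _ ≤ (8 / 5) ^ (c + 1) := pow_le_pow_right₀ (by norm_num) (by omega)

/-- W bounds what is supplied from outside, and W + 1 allows for `max q 1`. In a rank-k redex (λx.P)
Q the bound for Q takes the place of W in the estimate for P, so the bounds multiply, matching the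
additivity of the complexity. The base satisfies (8/5) ^ 2 - 3/2 ≥ 1, as a variable requires;
subtracting 3/2 leaves room for the additive terms. -/
theorem Tm.weight_le (k : ℕ) {Γ Δ : List Ty} {B : Ty} (M : Tm Γ Δ B) {v : Val Γ} {a : Val Δ}
    {q : ℕ} {W : ℝ} (hW : 0 ≤ W) (hv : ∀ C i, (v C i : ℝ) ≤ W + 1) (ha : ∀ C i, (a C i : ℝ) ≤ W)
    (hq : (q : ℝ) ≤ W) :
    (M.weight k v a q : ℝ) ≤ ((8 / 5) ^ (M.comp + 1) - 3 / 2) * (W + 1) + q := by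
  induction hn : M.comp using Nat.strong_induction_on generalizing Γ Δ B W q with
  | _ n ih =>
  subst hn
  have hmax : ∀ {p : ℕ} {V : ℝ}, 0 ≤ V → (p : ℝ) ≤ V → ((max p 1 : ℕ) : ℝ) ≤ V + 1 := by
    intro p V hV hp
    push_cast
    exact max_le (by linarith) (by linarith)
  have hmin : ∀ p : ℕ, ((min p 1 : ℕ) : ℝ) ≤ 1 := fun p => by
    exact_mod_cast min_le_right p 1
  have hX : ∀ {Γ Δ : List Ty} {A : Ty} (N : Tm Γ Δ A), (64 / 25 : ℝ) ≤ (8 / 5) ^ (N.comp + 1) :=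
    fun N => le_eight_fifths_pow N.one_le_comp
  cases M with
  | var x =>
    have := hv _ x
    simp only [weight, comp]
    push_cast
    nlinarith
  | lam P =>
    have h := ih _ (by simp only [comp]; omega) (q := 0) P hW
      (Val.cons_cast_le (hmax hW hq) hv) ha (by simpa using hW) rfl
    have := hX P
    simp only [weight, comp, pow_succ] at this h ⊢
    push_cast at h ⊢
    nlinarith
  | named α P =>
    have h := ih _ (by simp only [comp]; omega) P hW hv ha (ha _ α) rfl
    have := ha _ α
    have := hX P
    simp only [weight, comp, pow_succ] at this h ⊢
    push_cast at h ⊢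
    nlinarith
  | mu P =>
    have h := ih _ (by simp only [comp]; omega) (q := 0) P hW hv
      (Val.cons_cast_le hq ha) (by simpa using hW) rfl
    have := hX P
    have hm : ((min q 1 : ℕ) : ℝ) ≤ W := le_trans (by exact_mod_cast min_le_left q 1) hq
    simp only [weight, comp, pow_succ] at this h ⊢
    push_cast at h hm ⊢
    nlinarith
  | @app Γ Δ A _ U Q =>
    have hQ := ih _ (by have := U.one_le_comp; simp only [comp]; omega) (q := 0) Q hW hv ha
      (by simpa using hW) rfl
    have hxQ := hX Q
    have hQ1 := Q.one_le_comp
    simp only [Nat.cast_zero, add_zero] at hQ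
    by_cases hk : (Ty.arr A B).lh = k ∧ (U.IsLam ∨ U.IsMu)
    · obtain ⟨hk, hU⟩ := hk
      simp only [weight, if_pos hk]
      set E := Q.weight k v a 0
      set x : ℝ := (8 / 5) ^ (Q.comp + 1)
      have hWV : W ≤ (x - 3 / 2) * (W + 1) := by nlinarith
      have hV : 0 ≤ (x - 3 / 2) * (W + 1) := hW.trans hWV
      have hv' : ∀ C i, (v C i : ℝ) ≤ (x - 3 / 2) * (W + 1) + 1 := fun C i =>
        (hv C i).trans (by linarith)
      have ha' : ∀ C i, (a C i : ℝ) ≤ (x - 3 / 2) * (W + 1) := fun C i => (ha C i).trans hWV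
      cases U with
      | var y => exact (hU.elim id id).elim
      | app U N => exact (hU.elim id id).elim
      | lam P =>
        have h := ih _ (by simp only [comp]; omega) (q := 0) P hV
          (Val.cons_cast_le (hmax hV hQ) hv') ha' (by simpa using hV) rfl
        have hy := hX P
        have he : (8 / 5 : ℝ) ^ ((P.lam.app Q).comp + 1) = (8 / 5) ^ (P.comp + 1) * x := by
          rw [← pow_add]; simp only [comp]; ring_nf
        rw [he]
        simp only [weight]
        generalize (8 / 5 : ℝ) ^ (P.comp + 1) = y at h hy ⊢
        push_cast at h ⊢
        have := mul_nonneg (by linarith : (0 : ℝ) ≤ y - 1 / 2) hW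
        nlinarith
      | mu P =>
        have h := ih _ (by simp only [comp]; omega) (q := 0) P hV hv'
          (Val.cons_cast_le hQ ha') (by simpa using hV) rfl
        have hm := hmin E
        have he : (8 / 5 : ℝ) ^ ((P.mu.app Q).comp + 1) = (8 / 5) ^ (P.comp + 1) * x := by
          rw [← pow_add]; simp only [comp]; ring_nf
        rw [he]
        simp only [weight]
        -- The extra `min E 1` breaks the inductive estimate when P and Q both have complexity 1 and
        -- W = 0. If P has complexity 1 it is a variable, and its weight is known exactly.
        by_cases hP : 2 ≤ P.comp
        · have hy : (4 : ℝ) ≤ (8 / 5) ^ (P.comp + 1) :=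
            calc (4 : ℝ) ≤ (8 / 5) ^ 3 := by norm_num
              _ ≤ (8 / 5) ^ (P.comp + 1) := pow_le_pow_right₀ (by norm_num) (by omega)
          generalize (8 / 5 : ℝ) ^ (P.comp + 1) = y at h hy ⊢
          push_cast at h hm ⊢
          have := mul_nonneg (by linarith : (0 : ℝ) ≤ y - 1 / 2) hW
          nlinarith
        · cases P with
          | var y =>
            have := hv _ y
            simp only [weight, comp]
            push_cast at hm ⊢
            nlinarith
          | app M N =>
            have := M.one_le_comp
            have := N.one_le_comp
            simp only [comp] at hP
            omega
          | named α M => have := M.one_le_comp; simp only [comp] at hP; omega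
          | mu M => have := M.one_le_comp; simp only [comp] at hP; omega
    · have h := ih _ (by simp only [comp]; omega) (q := 0) U hW hv ha (by simpa using hW) rfl
      -- If U is not an abstraction, its weight is additive in the argument, so a rank-k application
      -- weighs the same as any other.
      have hw : (U.app Q).weight k v a q = U.weight k v a 0 + Q.weight k v a 0 + q := by
        simp only [weight]
        split_ifs with hk'
        · rw [U.weight_of_not_isLam_of_not_isMu k (fun h => hk ⟨hk', .inl h⟩)
            (fun h => hk ⟨hk', .inr h⟩)]
        · rfl
      have hy := hX U
      have he : (8 / 5 : ℝ) ^ ((U.app Q).comp + 1) =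
          (8 / 5) ^ (U.comp + 1) * (8 / 5) ^ (Q.comp + 1) * (5 / 8) := by
        rw [← pow_add, ← mul_right_inj' (by norm_num : (8 / 5 : ℝ) ≠ 0)]
        simp only [comp]
        ring
      rw [hw, he]
      generalize (8 / 5 : ℝ) ^ (U.comp + 1) = y at h hy ⊢
      generalize (8 / 5 : ℝ) ^ (Q.comp + 1) = x at hQ hxQ ⊢
      push_cast at h ⊢
      nlinarith [mul_nonneg (sub_nonneg.2 hy) (sub_nonneg.2 hxQ)]

/-- The weight of a term without assumptions on its variables and its context. -/
def Tm.totalWeight (k : ℕ) {Γ Δ : List Ty} {A : Ty} (M : Tm Γ Δ A) : ℕ :=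
  M.weight k (fun _ _ => 1) (fun _ _ => 0) 0

theorem Tm.comp_le_totalWeight (k : ℕ) {Γ Δ : List Ty} {A : Ty} (M : Tm Γ Δ A) :
    M.comp ≤ M.totalWeight k :=
  M.comp_add_le_weight k (fun _ _ => le_rfl) _ 0

theorem Tm.totalWeight_zero {Γ Δ : List Ty} {A : Ty} (M : Tm Γ Δ A) :
    M.totalWeight 0 = M.comp :=
  M.weight_zero (fun _ _ => rfl) fun _ _ => rfl

theorem RedexOcc.totalWeight_contract_add_two_le {k : ℕ} {Γ Δ : List Ty} {A : Ty} {M : Tm Γ Δ A}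
    (r : RedexOcc M) (hM : M.RankLE k) (hr : k ≤ r.rank) :
    r.contract.totalWeight k + 2 ≤ M.totalWeight k :=
  r.weight_contract_add_two_le hM hr (fun _ _ => le_rfl) (fun _ _ => .zero) .zero

theorem Tm.totalWeight_le (k : ℕ) {Γ Δ : List Ty} {A : Ty} (M : Tm Γ Δ A) :
    (M.totalWeight k : ℝ) ≤ (8 / 5) ^ (M.comp + 1) - 3 / 2 := by
  have := M.weight_le k (v := fun _ _ => 1) (a := fun _ _ => 0) (q := 0) (W := 0) le_rfl
    (fun _ _ => by simp) (fun _ _ => by simp) (by simp)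
  simpa [totalWeight] using this

/-! ### Numerical estimates -/

theorem eight_fifths_pow_le {c : ℕ} (hc : 1 ≤ c) : (8 / 5 : ℝ) ^ (c + 1) - 3 / 2 ≤ 2 ^ c := by
  -- For c = 1 and c = 2 the power alone exceeds 2 ^ c, and the term 3/2 is needed.
  obtain rfl | rfl | hc : c = 1 ∨ c = 2 ∨ 3 ≤ c := by omega
  · norm_num
  · norm_num
  · have : (8 / 5 : ℝ) ^ (c + 1) ≤ 2 ^ c := by
      induction c, hc using Nat.le_induction with
      | base => norm_num
      | succ c hc ih =>
        have := ih (by omega)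
        have h2 : (0 : ℝ) < 2 ^ c := by positivity
        rw [pow_succ, pow_succ (2 : ℝ)]
        linarith
    linarith

theorem Tm.totalWeight_le_two_pow (k : ℕ) {Γ Δ : List Ty} {A : Ty} (M : Tm Γ Δ A) :
    M.totalWeight k ≤ 2 ^ M.comp := by
  have := (M.totalWeight_le k).trans (eight_fifths_pow_le M.one_le_comp)
  exact_mod_cast this

theorem mul_eight_fifths_pow_lt (c : ℕ) :
    17 * ((c : ℝ) + 1) * ((8 / 5) ^ (c + 1) - 3 / 2) < 50 * 2 ^ c := by
  obtain hc | hc : c < 7 ∨ 7 ≤ c := by omega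
  · interval_cases c <;> norm_num
  · have : 17 * ((c : ℝ) + 1) * (8 / 5) ^ (c + 1) ≤ 50 * 2 ^ c := by
      induction c, hc using Nat.le_induction with
      | base => norm_num
      | succ c hc ih =>
        have hc' : (7 : ℝ) ≤ c := by exact_mod_cast hc
        have hx : (0 : ℝ) < (8 / 5) ^ (c + 1) := by positivity
        rw [pow_succ, pow_succ (2 : ℝ)]
        push_cast
        nlinarith
    have : (0 : ℝ) ≤ c := c.cast_nonneg
    nlinarith

/-- The product of the numbers `2 * s - 1` for `s = n, n - 2, n - 4, ...`, which bounds the measure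
of a reduction sequence along which a bound `s` for the complexity decreases by `2` from `n`. -/
def stepProd : ℕ → ℕ
  | 0 => 1
  | 1 => 1
  | n + 2 => (2 * n + 3) * stepProd n

theorem stepProd_le_succ : ∀ n, stepProd n ≤ stepProd (n + 1)
  | 0 => le_rfl
  | 1 => by decide
  | n + 2 => by
    have := stepProd_le_succ n
    simp only [stepProd]
    exact Nat.mul_le_mul (by omega) this

theorem stepProd_mono : Monotone stepProd :=
  monotone_nat_of_le_succ stepProd_le_succ

/-- Bernoulli's inequality for 1 + 2/(n + 1) with the real exponent (n + 2)/2, then squared. -/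
theorem sq_mul_pow_le (n : ℕ) : (2 * n + 3) ^ 2 * (n + 1) ^ n ≤ (n + 3) ^ (n + 2) := by
  have hn : (0 : ℝ) < n + 1 := by positivity
  have h := one_add_mul_self_le_rpow_one_add (s := 2 / ((n : ℝ) + 1)) (p := ((n : ℝ) + 2) / 2)
    (by have : 0 < 2 / ((n : ℝ) + 1) := by positivity
        linarith) (by have : (0 : ℝ) ≤ n := n.cast_nonneg
                      linarith)
  have h1 : 1 + ((n : ℝ) + 2) / 2 * (2 / ((n : ℝ) + 1)) = (2 * n + 3) / (n + 1) := by
    field_simp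
    ring
  have h2 : 1 + 2 / ((n : ℝ) + 1) = (n + 3) / (n + 1) := by
    field_simp
    ring
  rw [h1, h2] at h
  have h3 := pow_le_pow_left₀ (by positivity) h 2
  rw [← Real.rpow_natCast (_ ^ _) 2, ← Real.rpow_mul (by positivity)] at h3
  have h4 : ((n : ℝ) + 2) / 2 * (2 : ℕ) = (n + 2 : ℕ) := by
    push_cast
    ring
  rw [h4, Real.rpow_natCast, div_pow, div_pow, div_le_div_iff₀ (by positivity) (by positivity),
    pow_add ((n : ℝ) + 1), ← mul_assoc] at h3
  have h5 := le_of_mul_le_mul_right h3 (by positivity)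
  exact_mod_cast h5

theorem stepProd_sq_le : ∀ n, stepProd n ^ 2 ≤ (n + 1) ^ n
  | 0 => le_rfl
  | 1 => by decide
  | n + 2 => by
    rw [stepProd, mul_pow]
    exact (Nat.mul_le_mul_left _ (stepProd_sq_le n)).trans (sq_mul_pow_le n)

/-- The square of `stepProd n` is at most (n + 1) ^ n, hence at most (8/5) ^ ((c + 1) n). Since
(8/5) ^ 25 ≤ 2 ^ 17, the comparison is made between 50th powers, where all exponents are integers.
-/
theorem stepProd_lt {n c : ℕ} (h : (n : ℝ) ≤ (8 / 5) ^ (c + 1) - 3 / 2) :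
    stepProd n < 2 ^ 2 ^ c := by
  have h1 : 17 * (c + 1) * n < 50 * 2 ^ c := by
    have := mul_eight_fifths_pow_lt c
    have h2 : 17 * ((c : ℝ) + 1) * n ≤ 17 * ((c : ℝ) + 1) * ((8 / 5) ^ (c + 1) - 3 / 2) := by
      gcongr
    exact_mod_cast h2.trans_lt this
  have h2 : (stepProd n : ℝ) ^ 2 ≤ ((8 / 5) ^ (c + 1)) ^ n := by
    have h3 : (stepProd n : ℝ) ^ 2 ≤ ((n : ℝ) + 1) ^ n := by exact_mod_cast stepProd_sq_le n
    exact h3.trans (pow_le_pow_left₀ (by positivity) (by linarith) n)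
  have h3 : (stepProd n : ℝ) ^ 50 < ((2 : ℝ) ^ 2 ^ c) ^ 50 :=
    calc (stepProd n : ℝ) ^ 50 = ((stepProd n : ℝ) ^ 2) ^ 25 := by rw [← pow_mul]
      _ ≤ (((8 / 5) ^ (c + 1)) ^ n) ^ 25 := pow_le_pow_left₀ (by positivity) h2 25
      _ = ((8 / 5) ^ 25) ^ ((c + 1) * n) := by rw [← pow_mul, ← pow_mul, ← pow_mul]; ring_nf
      _ ≤ (2 ^ 17) ^ ((c + 1) * n) := pow_le_pow_left₀ (by positivity) (by norm_num) _
      _ = 2 ^ (17 * (c + 1) * n) := by rw [← pow_mul, mul_assoc]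
      _ < 2 ^ (50 * 2 ^ c) := pow_lt_pow_right₀ (by norm_num) h1
      _ = (2 ^ 2 ^ c) ^ 50 := by rw [← pow_mul, mul_comm]
  exact_mod_cast lt_of_pow_lt_pow_left₀ 50 (by positivity) h3

theorem tower_mono (k : ℕ) : Monotone (tower k) := by
  induction k with
  | zero => exact monotone_id
  | succ k ih => exact fun m n h => Nat.pow_le_pow_right two_pos (ih h)

theorem tower_succ_right (k m : ℕ) : tower (k + 1) m = tower k (2 ^ m) := by
  induction k with
  | zero => rfl
  | succ k ih => rw [tower, ih, tower]

/-- One exponential above this inequality, the summand n + 2 becomes the factor 2 ^ (n + 2) ≥ 2n + 3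
charged to a step. -/
theorem tower_add_le (k n : ℕ) : tower (k + 1) n + (n + 2) ≤ tower (k + 1) (n + 2) := by
  induction k with
  | zero =>
    have := n.lt_two_pow_self
    simp only [tower, pow_add]
    omega
  | succ k ih =>
    have h1 : 2 ^ (tower (k + 1) n + (n + 2)) ≤ tower (k + 2) (n + 2) :=
      Nat.pow_le_pow_right two_pos ih
    have h2 := n.lt_two_pow_self
    have h3 : 1 ≤ 2 ^ tower (k + 1) n := Nat.one_le_two_pow
    rw [pow_add, pow_add] at h1
    change 2 ^ tower (k + 1) n + (n + 2) ≤ _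
    nlinarith

theorem mul_tower_le (k n : ℕ) : (2 * n + 3) * tower (k + 2) n ≤ tower (k + 2) (n + 2) :=
  calc (2 * n + 3) * tower (k + 2) n ≤ 2 ^ (n + 2) * tower (k + 2) n := by
        have := n.lt_two_pow_self
        refine Nat.mul_le_mul_right _ ?_
        rw [pow_add]
        omega
    _ = 2 ^ (tower (k + 1) n + (n + 2)) := by rw [pow_add 2 (tower (k + 1) n), mul_comm]; rfl
    _ ≤ tower (k + 2) (n + 2) := Nat.pow_le_pow_right two_pos (tower_add_le k n)

/-! ### The measure of good reduction sequences -/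

theorem RedexOcc.IsGood.le_rank {k : ℕ} {Γ Δ : List Ty} {A : Ty} {M : Tm Γ Δ A}
    {r s : RedexOcc M} (hr : r.IsGood) (hs : k ≤ s.rank) : k ≤ r.rank := by
  rw [hr.1.1]
  exact hs.trans (le_csSup (bddAbove_rank M) ⟨s, rfl⟩)

/-- A bound for the terms without redexes of rank at least `k` in terms of the complexity gives
a bound for all terms whose `β`-, `μ`- and `ρ`-redexes have rank at most `k` in terms of the
weight. -/
theorem RedSeq.IsGood.measure_le {k : ℕ} {Γ Δ : List Ty} {A : Ty} {G : ℕ → ℕ} (hG : Monotone G)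
    (hstep : ∀ n, (2 * n + 3) * G n ≤ G (n + 2))
    (hbase : ∀ (M N : Tm Γ Δ A) (σ : RedSeq M N), σ.IsGood → N.IsNormal →
      (∀ r : RedexOcc M, r.rank < k) → σ.measure ≤ G M.comp)
    {M N : Tm Γ Δ A} {σ : RedSeq M N} (hσ : σ.IsGood) (hN : N.IsNormal) (hM : M.RankLE k) :
    σ.measure ≤ G (M.totalWeight k) := by
  induction σ with
  | nil M =>
    exact (hbase M M (.nil M) hσ hN fun r => (hN.false r).elim).trans
      (hG (M.comp_le_totalWeight k))
  | @cons M N r σ ih =>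
    by_cases h : ∀ s : RedexOcc M, s.rank < k
    · exact (hbase M N (.cons r σ) hσ hN h).trans (hG (M.comp_le_totalWeight k))
    · push Not at h
      obtain ⟨s, hs⟩ := h
      have h1 := r.totalWeight_contract_add_two_le hM (hσ.1.le_rank hs)
      have h2 := ih hσ.2 hN (r.rankLE_contract hM)
      -- Here n + 2 is the weight of M, so 2n + 3 is twice the weight minus 1 and dominates the
      -- factor of this step.
      obtain ⟨n, hn⟩ := Nat.exists_eq_add_of_le' (Nat.le_of_add_left_le h1)
      have h3 := r.one_add_max_m_le
      have h4 := M.comp_le_totalWeight k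
      rw [hn] at h1 h4 ⊢
      exact (Nat.mul_le_mul (by omega) (h2.trans (hG (by omega)))).trans (hstep n)

/-- Each step costs a factor 3 while lowering the complexity by at least 2, which is worth 4. The
spare factor 2 comes from comp ≥ 1 at the end and makes the bound strict. -/
theorem RedSeq.IsGood.measure_mul_two_le {Γ Δ : List Ty} {A : Ty} {M N : Tm Γ Δ A}
    {σ : RedSeq M N} (hσ : σ.IsGood) (hM : M.RankLE 0) : σ.measure * 2 ≤ 2 ^ M.comp := by
  induction σ with
  | nil M => exact Nat.pow_le_pow_right two_pos M.one_le_comp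
  | @cons M N r σ ih =>
    have h1 := ih hσ.2 (r.rankLE_contract hM)
    have h2 := r.totalWeight_contract_add_two_le hM (Nat.zero_le _)
    rw [Tm.totalWeight_zero, Tm.totalWeight_zero] at h2
    have h3 : r.m ≤ 2 := r.mAux_le_two hM _ (.inl rfl)
    have h4 := Nat.pow_le_pow_right two_pos h2
    rw [pow_add] at h4
    rw [RedSeq.measure, max_eq_right h3]
    omega

theorem RedSeq.IsGood.measure_le_stepProd {Γ Δ : List Ty} {A : Ty} {M N : Tm Γ Δ A}
    {σ : RedSeq M N} (hσ : σ.IsGood) (hN : N.IsNormal) (hM : M.RankLE 0) :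
    σ.measure ≤ stepProd M.comp := by
  rw [← M.totalWeight_zero]
  refine hσ.measure_le stepProd_mono (fun n => le_rfl) (fun M N σ _ _ h => ?_) hN hM
  cases σ with
  | nil M => exact stepProd_mono (Nat.zero_le _)
  | cons r σ => exact absurd (h r) (Nat.not_lt_zero _)

theorem RedSeq.IsGood.measure_lt_tower (k : ℕ) {Γ Δ : List Ty} {A : Ty} {M N : Tm Γ Δ A}
    {σ : RedSeq M N} (hσ : σ.IsGood) (hN : N.IsNormal) (hM : M.RankLE k) :
    σ.measure < tower (k + 1) M.comp := by
  induction k generalizing M N with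
  | zero =>
    have := hσ.measure_mul_two_le hM
    have : 0 < 2 ^ M.comp := by positivity
    simp only [tower]
    omega
  | succ k ih =>
    cases k with
    | zero =>
      refine lt_of_le_of_lt (hσ.measure_le stepProd_mono (fun n => le_rfl) ?_ hN hM)
        (stepProd_lt (M.totalWeight_le 1))
      exact fun M' N' σ' h hN' hr => h.measure_le_stepProd hN'
        (M'.rankLE_of_forall_rank_le fun r => Nat.le_of_lt_succ (hr r))
    | succ k =>
      have hpos : ∀ n, 0 < tower (k + 2) n := fun n => Nat.two_pow_pos _
      -- Subtracting 1 encodes the strict bound of the induction hypothesis in the non-strict form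
      -- that `measure_le` propagates.
      have h := hσ.measure_le (G := fun n => tower (k + 2) n - 1)
        (fun m n h => Nat.sub_le_sub_right (tower_mono (k + 2) h) 1)
        (fun n => by
          have := mul_tower_le k n
          simp only [Nat.mul_sub]
          omega)
        (fun M' N' σ' h hN' hr => Nat.le_sub_one_of_lt <| ih h hN'
          (M'.rankLE_of_forall_rank_le fun r => Nat.le_of_lt_succ (hr r)))
        hN hM
      have h2 := tower_mono (k + 2) (M.totalWeight_le_two_pow (k + 2))
      rw [← tower_succ_right] at h2
      have := hpos (M.totalWeight (k + 2))
      change _ ≤ tower (k + 2) (M.totalWeight (k + 2)) - 1 at h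
      change _ < tower (k + 2 + 1) _
      omega

end LambdaMu

theorem mainTheorem5 {Γ Δ : List LambdaMu.Ty} {A : LambdaMu.Ty}
    (M N : LambdaMu.Tm Γ Δ A) (k : ℕ) (hk : M.rank = k)
    (σ : LambdaMu.RedSeq M N) (hσ : σ.IsGood) (hN : N.IsNormal) :
    σ.measure < LambdaMu.tower (k + 1) M.comp :=
  hσ.measure_lt_tower k hN (M.rankLE_of_forall_rank_le fun r =>
    hk ▸ le_csSup (LambdaMu.bddAbove_rank M) ⟨r, rfl⟩)
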